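/- Consider session types generated by $A ::= \oplus\{\ell : A_\ell\}_{\ell\in L} \mid \&\{\ell : A_\ell\}_{\ell\in L} \mid A\otimes A \mid A\multimap A \mid \mathbf 1 \mid {?}\{\phi\}.A \mid {!}\{\phi\}.A \mid \exists n.A \mid \forall n.A \mid V[\overline e]$, with $L$ a finite nonempty set of labels, $\phi$ a proposition of Presburger arithmetic and $\overline e$ linear arithmetic expressions; arithmetic variables range over $\mathbb N$, expressions take values in $\mathbb Z$. A signature $\Sigma$ is a finite set of mutually recursive definitions $V[\overline n \mid \phi] = A$, one for each type variable $V$. A type is valid (with free variables $\mathcal V$, under a constraint $\mathcal C$) if for every occurrence of $V[\overline e]$ in it, $\mathcal C$ together with the assertions and assumptions above the occurrence entails $\overline e\ge 0$ and $\phi[\overline e/\overline n]$, where $\phi$ is the constraint of $V$; $\Sigma$ is valid if each right-hand side $A$ is valid with free variables $\overline n$ under $\phi$ and is not itself of the form $V'[\overline{e}']$. Type equality $A\equiv B$ of closed valid types is the largest type bisimulation: after unfolding a type variable at the top of $A$ and of $B$, the two types have the same outermost constructor (with the same label set, for choices) and related continuations (for all $i\in\mathbb N$ substituted for the bound variable,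 in the case of quantifiers), where $?\{\phi\}.A'$ and $?\{\psi\}.B'$ match if $\phi,\psi$ are both true and $A',B'$ are related, or if $\phi,\psi$ are both false, and likewise for $!$. In isorecursive type equality, unfolding a type variable is itself an observable message, so that a type variable is matched only by a type variable, and the unfolded types are then related. The fragment consists of the valid signatures and types built only from type definitions $V[\overline n]=A$ (with no constraint besides $\overline n\ge 0$), internal choice $\oplus$, and assertions ${?}\{c=0\}.A$ and ${?}\{c>0\}.A$ with $c$ an arithmetic variable. **Theorem 1.** Given a valid signature $\Sigma$ and types $A, B$ that are valid with free arithmetic variables $m, n$, it is undecidable whether $A[i/m,j/n]\equiv B[i/m,j/n]$ for concrete $i,j\in\mathbb N$. This holds already in the fragment, both for (equirecursive) type equality and for isorecursive type equality, in the following sense. 1. For every two-counter machine $\mathcal M$ there are $\Sigma, A, B$ in the fragment such that for all $i,j\in\mathbb N$: $A[i/m,j/n]\equiv B[i/m,j/n]$ if and only if the computation of $\mathcal M$ from its first instruction with initial counter values $i,j$ is infinite. The same $\Sigma,A,B$ have this property for isorecursive equality. 2. There are fixed $\Sigma, A, B$ in the fragment such that the set of pairs $(i,j)\in\mathbb N^2$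 with $A[i/m,j/n]\equiv B[i/m,j/n]$ is not computable, and neither is the corresponding set for isorecursive equality. 3. With $(\Sigma, A, B)$ as part of the input, however it is coded by a natural number, there is no partial recursive function that, on every input $(\Sigma,A,B,i,j)$ with $\Sigma, A, B$ in the fragment, halts and decides correctly whether $A[i/m,j/n]\equiv B[i/m,j/n]$; nor is there one for isorecursive equality. -/

import Mathlib

/-! Arithmetically refined session types, their validity and equality, and two-counter machines.
Arithmetic variables are de Bruijn indices: an object indexed by `k` has its free arithmetic
variables among `Fin k`, so an object indexed by `0` is closed. -/

namespace RefinedSession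

/-- Arithmetic expressions `i | e + e | e - e | i * e | n`. -/
inductive Exp (k : ℕ) : Type
  | const (i : ℕ) : Exp k
  | var (x : Fin k) : Exp k
  | add (e f : Exp k) : Exp k
  | sub (e f : Exp k) : Exp k
  | mul (i : ℕ) (e : Exp k) : Exp k

namespace Exp

/-- Integer value of an expression (subtraction is not truncated). -/
def eval {k : ℕ} (ρ : Fin k → ℤ) : Exp k → ℤ
  | const i => i
  | var x => ρ x
  | add e f => e.eval ρ + f.eval ρ
  | sub e f => e.eval ρ - f.eval ρ
  | mul i e => i * e.eval ρ

def subst {k l : ℕ} (σ : Fin k → Exp l) : Exp k → Exp l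
  | const i => const i
  | var x => σ x
  | add e f => add (e.subst σ) (f.subst σ)
  | sub e f => sub (e.subst σ) (f.subst σ)
  | mul i e => mul i (e.subst σ)

/-- Weakening by one fresh variable, which gets index `0`. -/
def weaken {k : ℕ} (e : Exp k) : Exp (k + 1) := e.subst fun x => var x.succ

end Exp

/-- Extension of a substitution under a binder; the bound variable is index `0`. -/
def liftSubst {k l : ℕ} (σ : Fin k → Exp l) : Fin (k + 1) → Exp (l + 1) :=
  Fin.cons (.var 0) fun x => (σ x).weaken

/-- Arithmetic propositions; `dvd i e` is divisibility of `e` by the constant `i`. -/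
inductive Prp : ℕ → Type
  | eq {k : ℕ} (e f : Exp k) : Prp k
  | gt {k : ℕ} (e f : Exp k) : Prp k
  | dvd {k : ℕ} (i : ℕ) (e : Exp k) : Prp k
  | tt {k : ℕ} : Prp k
  | ff {k : ℕ} : Prp k
  | and {k : ℕ} (φ ψ : Prp k) : Prp k
  | or {k : ℕ} (φ ψ : Prp k) : Prp k
  | not {k : ℕ} (φ : Prp k) : Prp k
  | ex {k : ℕ} (φ : Prp (k + 1)) : Prp k
  | all {k : ℕ} (φ : Prp (k + 1)) : Prp k

namespace Prp

/-- Truth of a proposition; quantified variables range over the natural numbers. -/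
def Holds : {k : ℕ} → Prp k → (Fin k → ℤ) → Prop
  | _, eq e f, ρ => e.eval ρ = f.eval ρ
  | _, gt e f, ρ => e.eval ρ > f.eval ρ
  | _, dvd i e, ρ => (i : ℤ) ∣ e.eval ρ
  | _, tt, _ => True
  | _, ff, _ => False
  | _, and φ ψ, ρ => φ.Holds ρ ∧ ψ.Holds ρ
  | _, or φ ψ, ρ => φ.Holds ρ ∨ ψ.Holds ρ
  | _, not φ, ρ => ¬ φ.Holds ρ
  | _, ex φ, ρ => ∃ i : ℕ, φ.Holds (Fin.cons (i : ℤ) ρ)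
  | _, all φ, ρ => ∀ i : ℕ, φ.Holds (Fin.cons (i : ℤ) ρ)

def subst : {k l : ℕ} → (Fin k → Exp l) → Prp k → Prp l
  | _, _, σ, eq e f => eq (e.subst σ) (f.subst σ)
  | _, _, σ, gt e f => gt (e.subst σ) (f.subst σ)
  | _, _, σ, dvd i e => dvd i (e.subst σ)
  | _, _, _, tt => tt
  | _, _, _, ff => ff
  | _, _, σ, and φ ψ => and (φ.subst σ) (ψ.subst σ)
  | _, _, σ, or φ ψ => or (φ.subst σ) (ψ.subst σ)
  | _, _, σ, not φ => not (φ.subst σ)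
  | _, _, σ, ex φ => ex (φ.subst (liftSubst σ))
  | _, _, σ, all φ => all (φ.subst (liftSubst σ))

def weaken {k : ℕ} (φ : Prp k) : Prp (k + 1) := φ.subst fun x => .var x.succ

/-- `𝒱 ; C ⊨ φ`, where the `k` variables in `𝒱` range over the natural numbers. -/
def Entails {k : ℕ} (C φ : Prp k) : Prop :=
  ∀ ρ : Fin k → ℕ, C.Holds (fun x => (ρ x : ℤ)) → φ.Holds (fun x => (ρ x : ℤ))

/-- `⊨ φ` for a closed proposition `φ`. -/
def Models (φ : Prp 0) : Prop := Entails tt φ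

end Prp

/-- Session types over `N` type variables, the type variable `V` taking `ar V` arithmetic
arguments. Labels are natural numbers; a choice has one continuation for each label of a finite
nonempty set. -/
inductive Ty {N : ℕ} (ar : Fin N → ℕ) : ℕ → Type
  /-- internal choice `⊕{ℓ : A_ℓ}` over `ℓ ∈ L` -/
  | ichoice {k : ℕ} (L : Finset ℕ) (hL : L.Nonempty) (A : {ℓ // ℓ ∈ L} → Ty ar k) : Ty ar k
  /-- external choice `&{ℓ : A_ℓ}` over `ℓ ∈ L` -/
  | echoice {k : ℕ} (L : Finset ℕ) (hL : L.Nonempty) (A : {ℓ // ℓ ∈ L} → Ty ar k) : Ty ar k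
  /-- `A ⊗ B` -/
  | tensor {k : ℕ} (A B : Ty ar k) : Ty ar k
  /-- `A ⊸ B` -/
  | lolli {k : ℕ} (A B : Ty ar k) : Ty ar k
  /-- the type `1` -/
  | one {k : ℕ} : Ty ar k
  /-- assertion `?{φ}. A` -/
  | assert {k : ℕ} (φ : Prp k) (A : Ty ar k) : Ty ar k
  /-- assumption `!{φ}. A` -/
  | assume {k : ℕ} (φ : Prp k) (A : Ty ar k) : Ty ar k
  /-- `∃n. A`, where `n` is index `0` in `A` -/
  | ex {k : ℕ} (A : Ty ar (k + 1)) : Ty ar k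
  /-- `∀n. A`, where `n` is index `0` in `A` -/
  | all {k : ℕ} (A : Ty ar (k + 1)) : Ty ar k
  /-- the instance `V[e₁, …]` of a defined type variable -/
  | tvar {k : ℕ} (V : Fin N) (es : Fin (ar V) → Exp k) : Ty ar k

namespace Ty

variable {N : ℕ} {ar : Fin N → ℕ}

def subst : {k l : ℕ} → (Fin k → Exp l) → Ty ar k → Ty ar l
  | _, _, σ, ichoice L hL A => ichoice L hL fun ℓ => (A ℓ).subst σ
  | _, _, σ, echoice L hL A => echoice L hL fun ℓ => (A ℓ).subst σ
  | _, _, σ, tensor A B => tensor (A.subst σ) (B.subst σ)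
  | _, _, σ, lolli A B => lolli (A.subst σ) (B.subst σ)
  | _, _, _, one => one
  | _, _, σ, assert φ A => assert (φ.subst σ) (A.subst σ)
  | _, _, σ, assume φ A => assume (φ.subst σ) (A.subst σ)
  | _, _, σ, ex A => ex (A.subst (liftSubst σ))
  | _, _, σ, all A => all (A.subst (liftSubst σ))
  | _, _, σ, tvar V es => tvar V fun x => (es x).subst σ

/-- `A[i/n]` for a type with the single free variable `n`. -/
def inst (A : Ty ar 1) (i : ℕ) : Ty ar 0 := A.subst fun _ => .const i

/-- `A[i/m, j/n]` for a type with the free variables `m` (index `0`) and `n` (index `1`). -/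
def inst₂ (A : Ty ar 2) (i j : ℕ) : Ty ar 0 := A.subst ![.const i, .const j]

def IsVar {k : ℕ} : Ty ar k → Prop
  | tvar _ _ => True
  | _ => False

/-- The type is built only from internal choice, instances of type variables, and assertions
`?{c = 0}. A` and `?{c > 0}. A` with an arithmetic variable `c`. -/
def InFragment : {k : ℕ} → Ty ar k → Prop
  | _, ichoice _ _ A => ∀ ℓ, (A ℓ).InFragment
  | _, assert φ A =>
      (∃ c, φ = .eq (.var c) (.const 0) ∨ φ = .gt (.var c) (.const 0)) ∧ A.InFragment
  | _, tvar _ _ => True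
  | _, _ => False

/-- The conditions that a type bisimulation imposes on a pair of structural closed types. -/
def Match (R : Ty ar 0 → Ty ar 0 → Prop) : Ty ar 0 → Ty ar 0 → Prop
  | ichoice L _ A, ichoice L' _ B =>
      L = L' ∧ ∀ ℓ (h : ℓ ∈ L) (h' : ℓ ∈ L'), R (A ⟨ℓ, h⟩) (B ⟨ℓ, h'⟩)
  | echoice L _ A, echoice L' _ B =>
      L = L' ∧ ∀ ℓ (h : ℓ ∈ L) (h' : ℓ ∈ L'), R (A ⟨ℓ, h⟩) (B ⟨ℓ, h'⟩)
  | tensor A₁ A₂, tensor B₁ B₂ => R A₁ B₁ ∧ R A₂ B₂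
  | lolli A₁ A₂, lolli B₁ B₂ => R A₁ B₁ ∧ R A₂ B₂
  | one, one => True
  | assert φ A, assert ψ B =>
      (φ.Models ∧ ψ.Models ∧ R A B) ∨ (φ.not.Models ∧ ψ.not.Models)
  | assume φ A, assume ψ B =>
      (φ.Models ∧ ψ.Models ∧ R A B) ∨ (φ.not.Models ∧ ψ.not.Models)
  | ex A, ex B => ∀ i : ℕ, R (A.inst i) (B.inst i)
  | all A, all B => ∀ i : ℕ, R (A.inst i) (B.inst i)
  | _, _ => False

end Ty

/-- A signature of `N` mutually recursive definitions `V[n₁, …, n_a | φ] = A`, with `a = arity V`,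
`φ = constr V` and `A = body V`. -/
structure Signature where
  N : ℕ
  arity : Fin N → ℕ
  constr : ∀ V : Fin N, Prp (arity V)
  body : ∀ V : Fin N, Ty arity (arity V)

namespace Signature

/-- `𝒱 ; C ⊢ A valid` in the signature `S`. An instance `V[e₁, …]` is valid if `C` entails that
the arguments are natural numbers that satisfy the constraint of `V`. -/
def ValidTy (S : Signature) : {k : ℕ} → Prp k → Ty S.arity k → Prop
  | _, C, .ichoice _ _ A => ∀ ℓ, S.ValidTy C (A ℓ)
  | _, C, .echoice _ _ A => ∀ ℓ, S.ValidTy C (A ℓ)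
  | _, C, .tensor A B => S.ValidTy C A ∧ S.ValidTy C B
  | _, C, .lolli A B => S.ValidTy C A ∧ S.ValidTy C B
  | _, _, .one => True
  | _, C, .assert φ A => S.ValidTy (C.and φ) A
  | _, C, .assume φ A => S.ValidTy (C.and φ) A
  | _, C, .ex A => S.ValidTy C.weaken A
  | _, C, .all A => S.ValidTy C.weaken A
  | k, C, .tvar V es =>
      (∀ ρ : Fin k → ℕ, C.Holds (fun x => (ρ x : ℤ)) →
        ∀ y, 0 ≤ (es y).eval (fun x => (ρ x : ℤ))) ∧
      C.Entails ((S.constr V).subst es)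

/-- Every definition is contractive and has a valid right-hand side. -/
def Valid (S : Signature) : Prop :=
  ∀ V, S.ValidTy (S.constr V) (S.body V) ∧ ¬ (S.body V).IsVar

/-- All right-hand sides are in the fragment, and all definitions are of the plain form
`V[n₁, …] = A`, without a constraint besides `n₁, … ≥ 0`. -/
def InFragment (S : Signature) : Prop :=
  ∀ V, S.constr V = .tt ∧ (S.body V).InFragment

def unfold (S : Signature) : Ty S.arity 0 → Ty S.arity 0
  | .tvar V es => (S.body V).subst es
  | A => A

/-- Type bisimulations (on closed valid types) for the equirecursive reading of definitions. -/
def IsBisimulation (S : Signature) (R : Ty S.arity 0 → Ty S.arity 0 → Prop) : Prop :=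
  ∀ A B, R A B → S.ValidTy .tt A ∧ S.ValidTy .tt B ∧ Ty.Match R (S.unfold A) (S.unfold B)

/-- Type equality `A ≡ B`. -/
def Equal (S : Signature) (A B : Ty S.arity 0) : Prop :=
  ∃ R, S.IsBisimulation R ∧ R A B

/-- Type bisimulations for the isorecursive reading of definitions: unfolding a type variable is
itself an observable message, so a type variable is matched only by a type variable. -/
def IsIsoBisimulation (S : Signature) (R : Ty S.arity 0 → Ty S.arity 0 → Prop) : Prop :=
  ∀ A B, R A B → S.ValidTy .tt A ∧ S.ValidTy .tt B ∧
    ((A.IsVar ∧ B.IsVar ∧ R (S.unfold A) (S.unfold B)) ∨ Ty.Match R A B)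

/-- Isorecursive type equality. -/
def IsoEqual (S : Signature) (A B : Ty S.arity 0) : Prop :=
  ∃ R, S.IsIsoBisimulation R ∧ R A B

end Signature

/-- A signature with two types `A`, `B` whose free arithmetic variables are among `m`, `n`. -/
structure TypePair where
  sig : Signature
  A : Ty sig.arity 2
  B : Ty sig.arity 2

namespace TypePair

/-- The signature is valid and `m, n ; ⊤ ⊢ A, B valid`. -/
def Valid (P : TypePair) : Prop :=
  P.sig.Valid ∧ P.sig.ValidTy .tt P.A ∧ P.sig.ValidTy .tt P.B

def InFragment (P : TypePair) : Prop :=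
  P.sig.InFragment ∧ P.A.InFragment ∧ P.B.InFragment

/-- `A[i/m, j/n] ≡ B[i/m, j/n]` -/
def EqualAt (P : TypePair) (i j : ℕ) : Prop :=
  P.sig.Equal (P.A.inst₂ i j) (P.B.inst₂ i j)

/-- `A[i/m, j/n] ≡ B[i/m, j/n]` for isorecursive type equality -/
def IsoEqualAt (P : TypePair) (i j : ℕ) : Prop :=
  P.sig.IsoEqual (P.A.inst₂ i j) (P.B.inst₂ i j)

end TypePair

/-- Instructions of a two-counter machine with `s` instructions. -/
inductive Instr (s : ℕ) : Type
  /-- increment counter `c` and go to instruction `k` -/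
  | inc (c : Fin 2) (k : Fin s) : Instr s
  /-- if counter `c` is zero go to instruction `k`, else decrement it and go to instruction `l` -/
  | zdec (c : Fin 2) (k l : Fin s) : Instr s
  | halt : Instr s

/-- A two-counter machine: a nonempty sequence of instructions, the first one with index `0`. -/
structure CounterMachine where
  m : ℕ
  code : Fin (m + 1) → Instr (m + 1)

namespace CounterMachine

/-- The index of the current instruction and the values of the two counters. -/
abbrev Config (M : CounterMachine) : Type := Fin (M.m + 1) × (Fin 2 → ℕ)

/-- The successor configuration, if there is one. -/
def step (M : CounterMachine) (C : M.Config) : Option M.Config :=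
  match M.code C.1 with
  | .inc c k => some (k, Function.update C.2 c (C.2 c + 1))
  | .zdec c k l =>
      if C.2 c = 0 then some (k, C.2) else some (l, Function.update C.2 c (C.2 c - 1))
  | .halt => none

/-- The computation started at the first instruction with counter values `i` and `j` is finite. -/
def Halts (M : CounterMachine) (i j : ℕ) : Prop :=
  ∃ C : M.Config, Relation.ReflTransGen (fun D E => M.step D = some E) (0, ![i, j]) C ∧
    M.step C = none

end CounterMachine

end RefinedSession

open RefinedSession

/-!
Type equality simulates two-counter machines. For a machine `M` take a signature with two copies of
each instruction `k` as type variables `T_k[c₀, c₁]` and `T'_k[c₀, c₁]`, whose arguments are the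
counter values. An increment unfolds to a choice with one label; a zero test unfolds to a choice
between `?{c = 0}` and `?{c > 0}`, of which exactly one assertion is true, so that only the branch
taken by `M` is ever compared. The copies differ in one place only: `halt` offers distinct labels.
If the computation from `(k, v)` is infinite, the pairs of corresponding types along it form a
bisimulation (`CounterMachine.Copies`); conversely, a bisimulation that relates the two copies
follows the computation and excludes that it reaches `halt`
(`CounterMachine.Simulates.not_haltsFrom`). Type variables are always paired with type variables, so
the same types work for isorecursive equality.

It remains to find a two-counter machine with an undecidable halting problem
(`CounterMachine.exists_universal`), which is Minsky's argument. Loop programs over finitely many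
registers compute every primitive recursive function (`Nat.Primrec'.computes`). Keeping the register
contents as exponents of the primes in a single counter, they compile to two-counter code, in which
an increment is a multiplication and a test with decrement is a division (`Prog.Exec.reaches`). One
unbounded loop around such a program searches for a zero of a primitive recursive function
(`Op.exists_search`). Applied to the step-bounded evaluation of partial recursive functions, this
gives a machine that halts on `(2 ^ c, 0)` exactly if the function with code `c` is defined at `0`.
As the signature obtained from this machine is fixed, its coding as part of an input is irrelevant,
and the last claim of the theorem follows from the second.
-/

namespace RefinedSession

/-! ### Closed propositions and expressions -/

theorem Prp.models_iff (φ : Prp 0) (ρ : Fin 0 → ℤ) : φ.Models ↔ φ.Holds ρ := by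
  constructor
  · intro h
    convert h Fin.elim0 trivial
  · intro h σ _
    convert h

theorem Prp.not_models_iff (φ : Prp 0) : φ.not.Models ↔ ¬ φ.Models := by
  rw [Prp.models_iff _ fun x => x.elim0, Prp.models_iff _ fun x => x.elim0]
  rfl

namespace CounterMachine

/-! ### The signature of a counter machine -/

/-- The arities of the type variables of `M.signature`: two copies of each instruction of `M`, both
with the values of the counters as arguments. -/
abbrev arity (M : CounterMachine) : Fin (2 * (M.m + 1)) → ℕ := fun _ => 2

/-- The type variable for instruction `k` in copy `b`, applied to the arguments `es`. -/
def call (M : CounterMachine) (b : Fin 2) (k : Fin (M.m + 1)) {l : ℕ} (es : Fin 2 → Exp l) :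
    Ty M.arity l :=
  .tvar (finProdFinEquiv (b, k)) es

/-- The type that describes one step of instruction `k`, in copy `b`, at the counter values `es`.
Only for `halt` do the two copies differ: they offer the distinct labels `0` and `1`. -/
def instrTy (M : CounterMachine) (b : Fin 2) (k : Fin (M.m + 1)) {l : ℕ} (es : Fin 2 → Exp l) :
    Ty M.arity l :=
  match M.code k with
  | .inc c k' => .ichoice {0} (by simp) fun _ =>
      M.call b k' (Function.update es c (.add (es c) (.const 1)))
  | .zdec c k' l' => .ichoice {0, 1} (by simp) fun ℓ =>
      if ℓ.1 = 0 then .assert (.eq (es c) (.const 0)) (M.call b k' es)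
      else .assert (.gt (es c) (.const 0))
        (M.call b l' (Function.update es c (.sub (es c) (.const 1))))
  | .halt => .ichoice {(b : ℕ)} (by simp) fun _ => M.call b k es

/-- The signature with the definitions `T_{b,k}[n₀, n₁] = M.instrTy b k ![n₀, n₁]`. -/
abbrev signature (M : CounterMachine) : Signature where
  N := 2 * (M.m + 1)
  arity := M.arity
  constr _ := .tt
  body V := M.instrTy (finProdFinEquiv.symm V).1 (finProdFinEquiv.symm V).2 Exp.var

/-- The first instructions of the two copies, at the counter values `m` and `n`. -/
def typePair (M : CounterMachine) : TypePair where
  sig := M.signature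
  A := M.call 0 0 Exp.var
  B := M.call 1 0 Exp.var

variable (M : CounterMachine)

theorem subst_call (b : Fin 2) (k : Fin (M.m + 1)) {l l' : ℕ} (es : Fin 2 → Exp l)
    (σ : Fin l → Exp l') :
    (M.call b k es).subst σ = M.call b k fun x => (es x).subst σ := by
  simp [call, Ty.subst]

theorem subst_update {l l' : ℕ} (es : Fin 2 → Exp l) (c : Fin 2) (e : Exp l)
    (σ : Fin l → Exp l') :
    (fun x => (Function.update es c e x).subst σ) =
      Function.update (fun x => (es x).subst σ) c (e.subst σ) := by
  funext x
  exact Function.apply_update (fun _ => Exp.subst σ) es c e x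

theorem subst_instrTy (b : Fin 2) (k : Fin (M.m + 1)) {l l' : ℕ} (es : Fin 2 → Exp l)
    (σ : Fin l → Exp l') :
    (M.instrTy b k es).subst σ = M.instrTy b k fun x => (es x).subst σ := by
  unfold instrTy
  cases M.code k with
  | inc c k' => simp [Ty.subst, subst_call, subst_update, Exp.subst]
  | zdec c k' l' =>
    simp only [Ty.subst, Ty.ichoice.injEq, heq_eq_eq, true_and]
    funext ℓ
    split <;> simp [Ty.subst, Prp.subst, subst_call, subst_update, Exp.subst]
  | halt => simp [Ty.subst, subst_call]

theorem unfold_call (b : Fin 2) (k : Fin (M.m + 1)) (es : Fin 2 → Exp 0) :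
    M.signature.unfold (M.call b k es) = M.instrTy b k es := by
  change (M.instrTy (finProdFinEquiv.symm (finProdFinEquiv (b, k))).1
    (finProdFinEquiv.symm (finProdFinEquiv (b, k))).2 Exp.var).subst es = _
  rw [subst_instrTy]
  simp [Exp.subst]

theorem not_isVar_instrTy (b : Fin 2) (k : Fin (M.m + 1)) {l : ℕ} (es : Fin 2 → Exp l) :
    ¬ (M.instrTy b k es).IsVar := by
  unfold instrTy
  cases M.code k <;> simp [Ty.IsVar]

theorem unfold_instrTy (b : Fin 2) (k : Fin (M.m + 1)) (es : Fin 2 → Exp 0) :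
    M.signature.unfold (M.instrTy b k es) = M.instrTy b k es := by
  unfold instrTy
  cases M.code k <;> rfl

/-! ### Validity -/

theorem validTy_call {l : ℕ} {C : Prp l} {es : Fin 2 → Exp l}
    (h : ∀ ρ : Fin l → ℕ, C.Holds (fun x => (ρ x : ℤ)) → ∀ y, 0 ≤ (es y).eval fun x => (ρ x : ℤ))
    (b : Fin 2) (k : Fin (M.m + 1)) : M.signature.ValidTy C (M.call b k es) := by
  unfold call
  simp only [Signature.ValidTy]
  exact ⟨h, fun ρ _ => by simp [Prp.subst, Prp.Holds]⟩

theorem validTy_instrTy {l : ℕ} {C : Prp l} {es : Fin 2 → Exp l}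
    (h : ∀ ρ : Fin l → ℕ, C.Holds (fun x => (ρ x : ℤ)) → ∀ y, 0 ≤ (es y).eval fun x => (ρ x : ℤ))
    (b : Fin 2) (k : Fin (M.m + 1)) : M.signature.ValidTy C (M.instrTy b k es) := by
  unfold instrTy
  cases M.code k with
  | inc c k' =>
    simp only [Signature.ValidTy]
    refine fun _ => M.validTy_call (fun ρ hρ y => ?_) _ _
    rw [Function.update_apply]
    split
    · have := h ρ hρ c
      simp only [Exp.eval]
      positivity
    · exact h ρ hρ y
  | zdec c k' l' =>
    simp only [Signature.ValidTy]
    intro ℓ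
    split
    · simp only [Signature.ValidTy]
      refine M.validTy_call (fun ρ hρ y => ?_) _ _
      exact h ρ hρ.1 y
    · simp only [Signature.ValidTy]
      refine M.validTy_call (fun ρ hρ y => ?_) _ _
      rw [Function.update_apply]
      split
      · have := hρ.2
        simp only [Prp.Holds, Exp.eval] at this ⊢
        omega
      · exact h ρ hρ.1 y
  | halt =>
    simp only [Signature.ValidTy]
    exact fun _ => M.validTy_call h _ _

theorem typePair_valid : M.typePair.Valid := by
  have h {l : ℕ} (C : Prp l) (ρ : Fin l → ℕ) (_ : C.Holds (fun x => (ρ x : ℤ))) (y : Fin l) :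
      0 ≤ (Exp.var y).eval fun x => (ρ x : ℤ) := by
    simp [Exp.eval]
  exact ⟨fun V => ⟨M.validTy_instrTy (h _) _ _, M.not_isVar_instrTy _ _ _⟩,
    M.validTy_call (h _) _ _, M.validTy_call (h _) _ _⟩

theorem inFragment_call (b : Fin 2) (k : Fin (M.m + 1)) {l : ℕ} (es : Fin 2 → Exp l) :
    (M.call b k es).InFragment := by
  simp [call, Ty.InFragment]

theorem typePair_inFragment : M.typePair.InFragment := by
  refine ⟨fun V => ⟨rfl, ?_⟩, M.inFragment_call _ _ _, M.inFragment_call _ _ _⟩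
  change (M.instrTy _ _ Exp.var).InFragment
  unfold instrTy
  cases M.code _ with
  | inc c k' => simp [Ty.InFragment, inFragment_call]
  | zdec c k' l' =>
    simp only [Ty.InFragment]
    intro ℓ
    split
    · exact ⟨⟨c, .inl rfl⟩, M.inFragment_call _ _ _⟩
    · exact ⟨⟨c, .inr rfl⟩, M.inFragment_call _ _ _⟩
  | halt => simp [Ty.InFragment, inFragment_call]

/-! ### Infinite computations give a bisimulation -/

/-- The computation started at the configuration `C` is finite. -/
def HaltsFrom (C : M.Config) : Prop :=
  ∃ D : M.Config, Relation.ReflTransGen (fun D E => M.step D = some E) C D ∧ M.step D = none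

theorem HaltsFrom.of_step {C D : M.Config} (h : M.step C = some D) (hD : M.HaltsFrom D) :
    M.HaltsFrom C :=
  let ⟨E, hE, hn⟩ := hD
  ⟨E, .head h hE, hn⟩

/-- The closed expressions `es` denote the counter values `v`. -/
def Denotes (es : Fin 2 → Exp 0) (v : Fin 2 → ℕ) : Prop :=
  ∀ y, (es y).eval (fun x => x.elim0) = v y

theorem Denotes.add {es : Fin 2 → Exp 0} {v : Fin 2 → ℕ} (h : Denotes es v) (c : Fin 2) :
    Denotes (Function.update es c (.add (es c) (.const 1))) (Function.update v c (v c + 1)) := by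
  intro y
  have := h c
  simp only [Function.update_apply]
  split
  · simp [Exp.eval, this]
  · exact h y

theorem Denotes.sub {es : Fin 2 → Exp 0} {v : Fin 2 → ℕ} (h : Denotes es v) {c : Fin 2}
    (hc : v c ≠ 0) :
    Denotes (Function.update es c (.sub (es c) (.const 1))) (Function.update v c (v c - 1)) := by
  intro y
  have := h c
  simp only [Function.update_apply]
  split
  · simp only [Exp.eval, this]
    push_cast
    omega
  · exact h y

theorem Denotes.models_eq {es : Fin 2 → Exp 0} {v : Fin 2 → ℕ} (h : Denotes es v) (c : Fin 2) :
    (Prp.eq (es c) (.const 0)).Models ↔ v c = 0 := by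
  rw [Prp.models_iff _ fun x => x.elim0]
  simp [Prp.Holds, Exp.eval, h c]

theorem Denotes.models_gt {es : Fin 2 → Exp 0} {v : Fin 2 → ℕ} (h : Denotes es v) (c : Fin 2) :
    (Prp.gt (es c) (.const 0)).Models ↔ v c ≠ 0 := by
  rw [Prp.models_iff _ fun x => x.elim0]
  simp [Prp.Holds, Exp.eval, h c, Nat.pos_iff_ne_zero]

/-- The pairs of corresponding types in the two copies, at configurations with an infinite
computation: instances of type variables, their unfoldings, and the assertions below these. -/
inductive Copies : Ty M.arity 0 → Ty M.arity 0 → Prop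
  | call (k : Fin (M.m + 1)) {es : Fin 2 → Exp 0} {v : Fin 2 → ℕ} (hes : Denotes es v)
      (hv : ¬ M.HaltsFrom (k, v)) : Copies (M.call 0 k es) (M.call 1 k es)
  | instr (k : Fin (M.m + 1)) {es : Fin 2 → Exp 0} {v : Fin 2 → ℕ} (hes : Denotes es v)
      (hv : ¬ M.HaltsFrom (k, v)) : Copies (M.instrTy 0 k es) (M.instrTy 1 k es)
  | assert (φ : Prp 0) (k : Fin (M.m + 1)) {es : Fin 2 → Exp 0}
      (hvalid : ∀ b, M.signature.ValidTy .tt (.assert φ (M.call b k es)))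
      (h : φ.Models → ∃ v, Denotes es v ∧ ¬ M.HaltsFrom (k, v)) :
      Copies (.assert φ (M.call 0 k es)) (.assert φ (M.call 1 k es))

variable {M}

theorem Denotes.nonneg {p : Prop} {es : Fin 2 → Exp 0} {v : Fin 2 → ℕ} (h : Denotes es v)
    (ρ : Fin 0 → ℕ) (_ : p) (y : Fin 2) : 0 ≤ (es y).eval fun x => (ρ x : ℤ) := by
  have := h y
  rw [Subsingleton.elim (fun x => (ρ x : ℤ)) fun x => x.elim0, this]
  positivity

theorem Copies.validTy {A B : Ty M.arity 0} (h : M.Copies A B) :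
    M.signature.ValidTy .tt A ∧ M.signature.ValidTy .tt B := by
  cases h with
  | call k hes hv => exact ⟨M.validTy_call hes.nonneg _ _, M.validTy_call hes.nonneg _ _⟩
  | instr k hes hv => exact ⟨M.validTy_instrTy hes.nonneg _ _, M.validTy_instrTy hes.nonneg _ _⟩
  | assert φ k hvalid h => exact ⟨hvalid 0, hvalid 1⟩

theorem Copies.match_instrTy {k : Fin (M.m + 1)} {es : Fin 2 → Exp 0} {v : Fin 2 → ℕ}
    (hes : Denotes es v) (hv : ¬ M.HaltsFrom (k, v)) :
    Ty.Match M.Copies (M.instrTy 0 k es) (M.instrTy 1 k es) := by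
  have hvalid (b : Fin 2) := M.validTy_instrTy (C := .tt) hes.nonneg b k
  have hstep {D : M.Config} (h : M.step (k, v) = some D) : ¬ M.HaltsFrom D :=
    fun hD => hv (hD.of_step M h)
  unfold instrTy at hvalid ⊢
  cases hk : M.code k with
  | inc c k' =>
    refine ⟨rfl, fun ℓ _ _ => .call k' (hes.add c) (hstep ?_)⟩
    simp [step, hk]
  | zdec c k' l' =>
    simp only [hk, Signature.ValidTy] at hvalid
    refine ⟨rfl, fun ℓ hℓ _ => ?_⟩
    have hval (b : Fin 2) := hvalid b ⟨ℓ, hℓ⟩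
    by_cases hℓ0 : ℓ = 0
    · simp only [hℓ0, if_true] at hval ⊢
      refine .assert _ k' hval fun h0 => ⟨v, hes, hstep ?_⟩
      simp [step, hk, (hes.models_eq c).1 h0]
    · simp only [hℓ0, if_false] at hval ⊢
      refine .assert _ l' hval fun h0 => ?_
      have h0 := (hes.models_gt c).1 h0
      refine ⟨_, hes.sub h0, hstep ?_⟩
      simp [step, hk, h0]
  | halt => exact absurd ⟨(k, v), .refl, by simp [step, hk]⟩ hv

/-- A false assertion matches its copy whatever follows it, so the branch of a zero test that is not
taken does not matter. -/
theorem Copies.match_assert {φ : Prp 0} {k : Fin (M.m + 1)} {es : Fin 2 → Exp 0}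
    (h : φ.Models → ∃ v, Denotes es v ∧ ¬ M.HaltsFrom (k, v)) :
    Ty.Match M.Copies (.assert φ (M.call 0 k es)) (.assert φ (M.call 1 k es)) := by
  by_cases hφ : φ.Models
  · obtain ⟨v, hes, hv⟩ := h hφ
    exact .inl ⟨hφ, hφ, .call k hes hv⟩
  · exact .inr ⟨φ.not_models_iff.2 hφ, φ.not_models_iff.2 hφ⟩

variable (M)

theorem isBisimulation_copies : M.signature.IsBisimulation M.Copies := by
  intro A B h
  refine ⟨h.validTy.1, h.validTy.2, ?_⟩
  cases h with
  | call k hes hv =>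
    rw [unfold_call, unfold_call]
    exact Copies.match_instrTy hes hv
  | instr k hes hv =>
    rw [unfold_instrTy, unfold_instrTy]
    exact Copies.match_instrTy hes hv
  | assert φ k hvalid h => exact Copies.match_assert h

theorem isIsoBisimulation_copies : M.signature.IsIsoBisimulation M.Copies := by
  intro A B h
  refine ⟨h.validTy.1, h.validTy.2, ?_⟩
  cases h with
  | call k hes hv =>
    rw [unfold_call, unfold_call]
    exact .inl ⟨trivial, trivial, .instr k hes hv⟩
  | instr k hes hv => exact Or.inr (Copies.match_instrTy hes hv)
  | assert φ k hvalid h => exact Or.inr (Copies.match_assert h)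

/-! ### Bisimulations exclude finite computations -/

/-- The consequence of both notions of bisimulation that a terminating computation contradicts:
related instances of type variables have matching unfoldings, and related assertions match. -/
def Simulates (R : Ty M.arity 0 → Ty M.arity 0 → Prop) : Prop :=
  (∀ k es, R (M.call 0 k es) (M.call 1 k es) → Ty.Match R (M.instrTy 0 k es) (M.instrTy 1 k es)) ∧
  ∀ φ A B, R (.assert φ A) (.assert φ B) → φ.Models → R A B

variable {M}

theorem simulates_of_isBisimulation {R : Ty M.arity 0 → Ty M.arity 0 → Prop}
    (h : M.signature.IsBisimulation R) : M.Simulates R := by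
  refine ⟨fun k es hR => ?_, fun φ A B hR hφ => ?_⟩
  · have := (h _ _ hR).2.2
    rwa [unfold_call, unfold_call] at this
  · rcases (h _ _ hR).2.2 with h | h
    · exact h.2.2
    · exact absurd hφ (φ.not_models_iff.1 h.1)

theorem simulates_of_isIsoBisimulation {R : Ty M.arity 0 → Ty M.arity 0 → Prop}
    (h : M.signature.IsIsoBisimulation R) : M.Simulates R := by
  refine ⟨fun k es hR => ?_, fun φ A B hR hφ => ?_⟩
  · rcases (h _ _ hR).2.2 with ⟨_, _, h'⟩ | h'
    · rw [unfold_call, unfold_call] at h'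
      rcases (h _ _ h').2.2 with ⟨hV, _⟩ | h''
      · exact absurd hV (M.not_isVar_instrTy _ _ _)
      · exact h''
    · exact absurd h' id
  · rcases (h _ _ hR).2.2 with ⟨hV, _⟩ | h | h
    · exact absurd hV id
    · exact h.2.2
    · exact absurd hφ (φ.not_models_iff.1 h.1)

/-- A related pair of instances follows the computation step by step, so at a `halt` the two
distinct labels would have to match. -/
theorem Simulates.not_haltsFrom {R : Ty M.arity 0 → Ty M.arity 0 → Prop} (h : M.Simulates R)
    {C : M.Config} {es : Fin 2 → Exp 0} (hes : Denotes es C.2)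
    (hR : R (M.call 0 C.1 es) (M.call 1 C.1 es)) : ¬ M.HaltsFrom C := by
  rintro ⟨D, hD, hn⟩
  induction hD using Relation.ReflTransGen.head_induction_on generalizing es with
  | refl =>
    have hm := h.1 _ _ hR
    cases hk : M.code D.1 with
    | halt =>
      simp only [instrTy, hk, Ty.Match] at hm
      simpa using hm.1
    | inc c k' => simp [step, hk] at hn
    | zdec c k' l' =>
      simp only [step, hk] at hn
      split at hn <;> simp at hn
  | @head C E hCE _ ih =>
    have hm := h.1 _ _ hR
    cases hk : M.code C.1 with
    | halt => simp [step, hk] at hCE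
    | inc c k' =>
      simp only [step, hk, Option.some.injEq] at hCE
      simp only [instrTy, hk, Ty.Match] at hm
      subst hCE
      exact ih (hes.add c) (hm.2 0 (by simp) (by simp))
    | zdec c k' l' =>
      simp only [step, hk] at hCE
      simp only [instrTy, hk, Ty.Match] at hm
      split at hCE
      · rename_i hc
        simp only [Option.some.injEq] at hCE
        subst hCE
        have := hm.2 0 (by simp) (by simp)
        simp only [if_true] at this
        exact ih hes (h.2 _ _ _ this ((hes.models_eq c).2 hc))
      · rename_i hc
        simp only [Option.some.injEq] at hCE
        subst hCE
        have := hm.2 1 (by simp) (by simp)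
        simp only [one_ne_zero, if_false] at this
        exact ih (hes.sub hc) (h.2 _ _ _ this ((hes.models_gt c).2 hc))

variable (M)

theorem inst₂_call (b : Fin 2) (i j : ℕ) :
    (M.call b 0 Exp.var).inst₂ i j = M.call b 0 ![.const i, .const j] := by
  simp [Ty.inst₂, subst_call, Exp.subst]

theorem denotes_const (i j : ℕ) : Denotes ![.const i, .const j] ![i, j] := by
  intro y
  fin_cases y <;> simp [Exp.eval]

theorem typePair_equalAt_iff (i j : ℕ) : M.typePair.EqualAt i j ↔ ¬ M.Halts i j := by
  unfold TypePair.EqualAt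
  constructor
  · rintro ⟨R, hR, h⟩
    refine (simulates_of_isBisimulation hR).not_haltsFrom (C := (0, ![i, j]))
      (denotes_const i j) ?_
    rw [← inst₂_call, ← inst₂_call]
    exact h
  · intro h
    refine ⟨_, M.isBisimulation_copies, ?_⟩
    change M.Copies ((M.call 0 0 Exp.var).inst₂ i j) ((M.call 1 0 Exp.var).inst₂ i j)
    rw [inst₂_call, inst₂_call]
    exact .call 0 (denotes_const i j) h

theorem typePair_isoEqualAt_iff (i j : ℕ) : M.typePair.IsoEqualAt i j ↔ ¬ M.Halts i j := by
  unfold TypePair.IsoEqualAt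
  constructor
  · rintro ⟨R, hR, h⟩
    refine (simulates_of_isIsoBisimulation hR).not_haltsFrom (C := (0, ![i, j]))
      (denotes_const i j) ?_
    rw [← inst₂_call, ← inst₂_call]
    exact h
  · intro h
    refine ⟨_, M.isIsoBisimulation_copies, ?_⟩
    change M.Copies ((M.call 0 0 Exp.var).inst₂ i j) ((M.call 1 0 Exp.var).inst₂ i j)
    rw [inst₂_call, inst₂_call]
    exact .call 0 (denotes_const i j) h

end CounterMachine

/-! ### Loop programs over registers -/

/-- Programs over registers with values in `ℕ`. `loop r p` decrements `r` and runs `p` as long as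
`r` is not zero. -/
inductive Prog : Type
  | skip : Prog
  | inc (r : ℕ) : Prog
  | seq (p q : Prog) : Prog
  | loop (r : ℕ) (p : Prog) : Prog

namespace Prog

open Finsupp

/-- `Exec p s t`: the program `p` started with register contents `s` terminates with contents
`t`. -/
inductive Exec : Prog → (ℕ →₀ ℕ) → (ℕ →₀ ℕ) → Prop
  | skip (s) : Exec skip s s
  | inc (r s) : Exec (inc r) s (s + single r 1)
  | seq {p q s t u} : Exec p s t → Exec q t u → Exec (seq p q) s u
  | loop_zero {r p s} : s r = 0 → Exec (loop r p) s s
  | loop_succ {r p s t u} : Exec p s t → Exec (loop r p) t u → Exec (loop r p) (s + single r 1) u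

theorem Exec.congr {p : Prog} {s s' t t' : ℕ →₀ ℕ} (h : Exec p s t) (hs : s = s') (ht : t = t') :
    Exec p s' t' := hs ▸ ht ▸ h

/-- A loop runs through the states `G 0, G 1, …`, to which the loop counter is added. -/
theorem exec_loop {r : ℕ} {p : Prog} {G : ℕ → ℕ →₀ ℕ}
    (h : ∀ i m, Exec p (G i + single r m) (G (i + 1) + single r m)) (h0 : ∀ i, G i r = 0)
    (n i : ℕ) : Exec (loop r p) (G i + single r n) (G (i + n)) := by
  induction n generalizing i with
  | zero => simpa using Exec.loop_zero (h0 i)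
  | succ n ih =>
    have := Exec.loop_succ (r := r) (h i n) (ih (i + 1))
    exact this.congr (by rw [add_assoc, ← single_add]) (by congr 1; omega)

/-- Set register `r` to zero. -/
def clear (r : ℕ) : Prog := loop r skip

theorem exec_clear {r : ℕ} {s : ℕ →₀ ℕ} (h : s r = 0) (n : ℕ) :
    Exec (clear r) (s + single r n) s :=
  exec_loop (G := fun _ => s) (fun _ _ => .skip _) (fun _ => h) n 0

/-- Add register `a` to register `b` and set `a` to zero. -/
def move (a b : ℕ) : Prog := loop a (inc b)

theorem exec_move {a b : ℕ} {s : ℕ →₀ ℕ} (hab : a ≠ b) (h : s a = 0) (n : ℕ) :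
    Exec (move a b) (s + single a n) (s + single b n) := by
  refine (exec_loop (G := fun i => s + single b i) (fun i m => ?_) (fun i => ?_) n 0).congr
    (by simp) (by simp)
  · exact (Exec.inc b _).congr rfl (by rw [single_add]; abel)
  · simp [h, hab.symm]

/-- Add register `a` to register `b`, with the help of a register `t` that is zero before and
after. -/
def copy (a b t : ℕ) : Prog := seq (loop a (seq (inc b) (inc t))) (move t a)

theorem exec_copy {a b t : ℕ} {s : ℕ →₀ ℕ} (hab : a ≠ b) (hat : a ≠ t) (hbt : b ≠ t)
    (h : s t = 0) : Exec (copy a b t) s (s + single b (s a)) := by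
  obtain ⟨u, n, hu, rfl⟩ : ∃ u n, u a = 0 ∧ s = u + single a n :=
    ⟨s.erase a, s a, erase_same, (erase_add_single a s).symm⟩
  have hut : u t = 0 := by simpa [hat] using h
  refine .seq (t := u + single b n + single t n) ?_ ?_
  · refine (exec_loop (G := fun i => u + single b i + single t i) (fun i m => ?_)
      (fun i => ?_) n 0).congr (by simp) (by simp)
    · refine ((Exec.inc b _).seq (Exec.inc t _)).congr rfl ?_
      rw [single_add, single_add]
      abel
    · simp [hu, hab.symm, hat.symm]
  · refine (exec_move (s := u + single b n) hat.symm ?_ n).congr rfl ?_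
    · simp [hut, hbt]
    · simp only [Finsupp.add_apply, hu, single_eq_same, zero_add]
      abel

/-! ### Loop programs compute the primitive recursive functions -/

/-- For every choice of argument registers below `N`, some program adds the value of `f` to
register `N`, provided that all registers from `N` on are zero, and changes nothing else. -/
def Computes {n : ℕ} (f : List.Vector ℕ n → ℕ) : Prop :=
  ∀ (ins : Fin n → ℕ) (N : ℕ), (∀ i, ins i < N) → ∃ p, ∀ (s : ℕ →₀ ℕ) (v : List.Vector ℕ n),
    (∀ r, N ≤ r → s r = 0) → (∀ i, s (ins i) = v.get i) → Exec p s (s + single N (f v))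

theorem computes_comp {m n : ℕ} {f : List.Vector ℕ n → ℕ} {g : Fin n → List.Vector ℕ m → ℕ}
    (hf : Computes f) (hg : ∀ i, Computes (g i)) :
    Computes fun a => f (List.Vector.ofFn fun i => g i a) := by
  intro ins N hins
  let G (v : List.Vector ℕ m) (i : ℕ) : ℕ := if h : i < n then g ⟨i, h⟩ v else 0
  have hargs (j : ℕ) (hj : j ≤ n) : ∃ p, ∀ (s : ℕ →₀ ℕ) (v : List.Vector ℕ m),
      (∀ r, N ≤ r → s r = 0) → (∀ i, s (ins i) = v.get i) →
        Exec p s (s + ∑ i ∈ Finset.range j, single (N + 1 + i) (G v i)) := by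
    induction j with
    | zero => exact ⟨skip, fun s v _ _ => by simpa using Exec.skip s⟩
    | succ j ih =>
      obtain ⟨p, hp⟩ := ih (by omega)
      obtain ⟨q, hq⟩ := hg ⟨j, hj⟩ ins (N + 1 + j) fun i => (hins i).trans (by omega)
      refine ⟨seq p q, fun s v hs hv => (hp s v hs hv).seq ((hq _ v ?_ ?_).congr rfl ?_)⟩
      · intro r hr
        rw [Finsupp.add_apply, hs r (by omega), Finsupp.finsetSum_apply, zero_add]
        refine Finset.sum_eq_zero fun i hi => ?_
        have := Finset.mem_range.1 hi
        exact single_eq_of_ne (by omega)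
      · intro i
        have := hins i
        rw [Finsupp.add_apply, hv, Finsupp.finsetSum_apply, Finset.sum_eq_zero, add_zero]
        exact fun k _ => single_eq_of_ne (by omega)
      · have hj' : j < n := hj
        rw [Finset.sum_range_succ, add_assoc]
        simp [G, hj']
  have hclear (j : ℕ) : ∃ p, ∀ (s : ℕ →₀ ℕ) (a : ℕ → ℕ), (∀ r, N + 1 ≤ r → s r = 0) →
      Exec p (s + ∑ i ∈ Finset.range j, single (N + 1 + i) (a i)) s := by
    induction j with
    | zero => exact ⟨skip, fun s a _ => by simpa using Exec.skip s⟩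
    | succ j ih =>
      obtain ⟨p, hp⟩ := ih
      refine ⟨seq (clear (N + 1 + j)) p, fun s a hs => .seq ?_ (hp s a hs)⟩
      refine (exec_clear ?_ (a j)).congr (by rw [Finset.sum_range_succ, add_assoc]) rfl
      rw [Finsupp.add_apply, hs _ (by omega), Finsupp.finsetSum_apply, zero_add]
      refine Finset.sum_eq_zero fun i hi => ?_
      have := Finset.mem_range.1 hi
      exact single_eq_of_ne (by omega)
  -- The arguments of `f` are in the registers from `N + 1` on, its value first in `N + 1 + n`.
  -- Register `N` is kept free, so that the final `move` is between distinct registers also if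
  -- `n = 0`.
  obtain ⟨p, hp⟩ := hargs n le_rfl
  obtain ⟨q, hq⟩ := hf (fun i => N + 1 + i) (N + 1 + n) fun i => by omega
  obtain ⟨c, hc⟩ := hclear n
  refine ⟨seq p (seq q (seq (move (N + 1 + n) N) c)), fun s v hs hv => (hp s v hs hv).seq ?_⟩
  refine (hq _ (List.Vector.ofFn fun i => g i v) ?_ ?_).seq (.seq ?_ (hc _ (G v) ?_))
  · intro r hr
    rw [Finsupp.add_apply, hs r (by omega), Finsupp.finsetSum_apply, zero_add]
    refine Finset.sum_eq_zero fun i hi => ?_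
    have := Finset.mem_range.1 hi
    exact single_eq_of_ne (by omega)
  · intro i
    rw [Finsupp.add_apply, hs _ (by omega), Finsupp.finsetSum_apply, zero_add,
      Finset.sum_eq_single (i : ℕ)]
    · simp [G]
    · exact fun k _ hk => single_eq_of_ne (by omega)
    · simp
  · refine (exec_move (by omega) ?_ _).congr rfl (add_right_comm _ _ _)
    rw [Finsupp.add_apply, hs _ (by omega), Finsupp.finsetSum_apply, zero_add]
    refine Finset.sum_eq_zero fun i hi => ?_
    have := Finset.mem_range.1 hi
    exact single_eq_of_ne (by omega)
  · intro r hr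
    rw [Finsupp.add_apply, hs r (by omega), single_eq_of_ne (by omega), add_zero]

theorem computes_prec {n : ℕ} {f : List.Vector ℕ n → ℕ} {g : List.Vector ℕ (n + 2) → ℕ}
    (hf : Computes f) (hg : Computes g) :
    Computes fun v : List.Vector ℕ (n + 1) =>
      v.head.rec (f v.tail) fun y IH => g (y ::ᵥ IH ::ᵥ v.tail) := by
  intro ins N hins
  -- The loop counter is in register `N`, the value so far in `N + 1`, and its index in `N + 2`.
  obtain ⟨p, hp⟩ := hf (fun i => ins i.succ) (N + 1) fun i => (hins _).trans (by omega)
  obtain ⟨q, hq⟩ := hg (Fin.cons (N + 2) (Fin.cons (N + 1) fun i => ins i.succ)) (N + 3) (by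
    intro i
    refine Fin.cases ?_ (fun i => ?_) i
    · simp
    · refine Fin.cases ?_ (fun i => ?_) i
      · simp
      · have := hins i.succ
        simp only [Fin.cons_succ]
        omega)
  refine ⟨seq (copy (ins 0) N (N + 1)) (seq p (seq (loop N (seq q (seq (clear (N + 1))
    (seq (move (N + 3) (N + 1)) (inc (N + 2)))))) (seq (clear (N + 2)) (move (N + 1) N)))),
    fun s v hs hv => ?_⟩
  have h0 := hins 0
  have hsucc (i : Fin n) := hins i.succ
  let F (i : ℕ) : ℕ := Nat.rec (f v.tail) (fun y IH => g (y ::ᵥ IH ::ᵥ v.tail)) i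
  let G (i : ℕ) : ℕ →₀ ℕ := s + single (N + 1) (F i) + single (N + 2) i
  refine (exec_copy (by omega) (by omega) (by omega) (hs _ (by omega))).seq ?_
  rw [show s (ins 0) = v.head by rw [hv, List.Vector.get_zero]]
  refine .seq (t := G 0 + single N v.head) ?_ (.seq (t := G v.head) ?_ ?_)
  · refine (hp _ v.tail ?_ ?_).congr rfl ?_
    · intro r hr
      rw [Finsupp.add_apply, hs r (by omega), single_eq_of_ne (by omega), add_zero]
    · intro i
      have := hsucc i
      rw [Finsupp.add_apply, hv, single_eq_of_ne (by omega), List.Vector.get_tail_succ, add_zero]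
    · simp only [G, F, single_zero, add_zero]
      abel
  · refine (exec_loop (fun i m => ?_) (fun i => ?_) v.head 0).congr rfl (by rw [zero_add])
    · refine .seq (t := s + single (N + 2) i + single N m + single (N + 3) (F (i + 1)) +
        single (N + 1) (F i)) ((hq _ (i ::ᵥ F i ::ᵥ v.tail) ?_ ?_).congr rfl ?_) ?_
      · intro r hr
        simp only [G, Finsupp.add_apply]
        rw [hs r (by omega), single_eq_of_ne (by omega), single_eq_of_ne (by omega),
          single_eq_of_ne (by omega)]
        simp
      · intro j
        refine Fin.cases ?_ (fun j => ?_) j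
        · simp [G, hs]
        · refine Fin.cases ?_ (fun j => ?_) j
          · simpa [G, hs] using (List.Vector.get_cons_succ i (F i ::ᵥ v.tail) 0).symm
          · have := hsucc j
            simp only [G, Finsupp.add_apply, Fin.cons_succ]
            rw [hv, single_eq_of_ne (by omega), single_eq_of_ne (by omega),
              single_eq_of_ne (by omega)]
            simp
      · simp only [G, F]
        abel
      · refine (exec_clear ?_ _).seq (.seq (exec_move (by omega) ?_ _)
          ((Exec.inc _ _).congr rfl ?_))
        · simp [hs]
        · simp [hs]
        · simp only [G, single_add]
          abel
    · simp [G, hs]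
  · refine (exec_clear ?_ _).seq (exec_move (by omega) (hs _ (by omega)) _)
    simp [hs]

theorem _root_.Nat.Primrec'.computes {n : ℕ} {f : List.Vector ℕ n → ℕ} (hf : Nat.Primrec' f) :
    Computes f := by
  induction hf with
  | zero => exact fun _ _ _ => ⟨skip, fun s _ _ _ => by simpa using Exec.skip s⟩
  | succ =>
    intro ins N hins
    have h0 := hins 0
    refine ⟨seq (copy (ins 0) N (N + 1)) (inc N), fun s v hs hv => ?_⟩
    refine (exec_copy (by omega) (by omega) (by omega) (hs _ (by omega))).seq
      ((Exec.inc _ _).congr rfl ?_)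
    rw [hv, List.Vector.get_zero, add_assoc, ← single_add]
  | get i =>
    intro ins N hins
    have h0 := hins i
    refine ⟨copy (ins i) N (N + 1), fun s v hs hv => ?_⟩
    exact (exec_copy (t := N + 1) (by omega) (by omega) (by omega)
      (hs _ (by omega))).congr rfl (by rw [hv])
  | comp g _ _ hf hg => exact computes_comp hf hg
  | prec _ _ hf hg => exact computes_prec hf hg

end Prog

/-! ### Two-counter code with natural numbers as instruction addresses -/

/-- Instructions of a two-counter machine with arbitrary natural numbers as addresses. -/
inductive Op : Type
  | inc (c : Fin 2) (k : ℕ) : Op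
  | zdec (c : Fin 2) (k l : ℕ) : Op
  | halt : Op

namespace Op

open StateTransition

/-- One step of `code` from an address and two counter values. -/
def next (code : ℕ → Op) (C : ℕ × (Fin 2 → ℕ)) : Option (ℕ × (Fin 2 → ℕ)) :=
  match code C.1 with
  | inc c k => some (k, Function.update C.2 c (C.2 c + 1))
  | zdec c k l =>
      if C.2 c = 0 then some (k, C.2) else some (l, Function.update C.2 c (C.2 c - 1))
  | halt => none

/-- The configuration at address `p` with value `x` in counter `c` and `y` in the other one. -/
def conf (c : Fin 2) (p x y : ℕ) : ℕ × (Fin 2 → ℕ) := (p, fun d => if d = c then x else y)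

theorem conf_rev (c : Fin 2) (p x y : ℕ) : conf c.rev p x y = conf c p y x := by
  unfold conf
  congr 1
  funext d
  revert c d
  simp [Fin.forall_fin_two]

variable {code : ℕ → Op}

theorem next_inc {c : Fin 2} {p k : ℕ} (h : code p = inc c k) (x y : ℕ) :
    Reaches₁ (next code) (conf c p x y) (conf c k (x + 1) y) := by
  refine .single ?_
  simp only [next, conf, h, if_true, Option.mem_some_iff, Prod.mk.injEq, true_and]
  funext d
  simp only [Function.update_apply]
  split <;> rfl

theorem next_zdec_zero {c : Fin 2} {p k l : ℕ} (h : code p = zdec c k l) (y : ℕ) :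
    Reaches₁ (next code) (conf c p 0 y) (conf c k 0 y) := by
  refine .single ?_
  simp [next, conf, h]

theorem next_zdec_succ {c : Fin 2} {p k l : ℕ} (h : code p = zdec c k l) (x y : ℕ) :
    Reaches₁ (next code) (conf c p (x + 1) y) (conf c l x y) := by
  refine .single ?_
  simp only [next, conf, h, if_true, Nat.add_eq_zero_iff, one_ne_zero, and_false, if_false,
    Option.mem_some_iff, Prod.mk.injEq, true_and, Nat.add_sub_cancel]
  funext d
  simp only [Function.update_apply]
  split <;> rfl

/-- The list `l` of instructions is found in `code` from address `p` on. -/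
def CodeAt (code : ℕ → Op) (p : ℕ) (l : List Op) : Prop :=
  ∀ i (h : i < l.length), code (p + i) = l[i]

theorem codeAt_append {p : ℕ} {l l' : List Op} :
    CodeAt code p (l ++ l') ↔ CodeAt code p l ∧ CodeAt code (p + l.length) l' := by
  constructor
  · intro h
    refine ⟨fun i hi => ?_, fun i hi => ?_⟩
    · rw [h i (by simp; omega), List.getElem_append_left]
    · rw [add_assoc, h (l.length + i) (by simp; omega)]
      simp
  · rintro ⟨h, h'⟩ i hi
    by_cases hil : i < l.length
    · rw [h i hil, List.getElem_append_left]
    · obtain ⟨j, rfl⟩ := Nat.exists_eq_add_of_le (not_lt.1 hil)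
      rw [← add_assoc, h' j (by simp at hi; omega)]
      simp

theorem codeAt_singleton {p : ℕ} {o : Op} : CodeAt code p [o] ↔ code p = o := by
  simp [CodeAt]

theorem codeAt_map_range {p q : ℕ} {f : ℕ → Op} :
    CodeAt code p ((List.range q).map f) ↔ ∀ i < q, code (p + i) = f i := by
  simp [CodeAt]

/-! ### Multiplication and division of one counter -/

/-- Add `q` to counter `c`. -/
def incs (c : Fin 2) (q p : ℕ) : List Op := (List.range q).map fun i => inc c (p + i + 1)

theorem reaches_incs {c : Fin 2} {q p : ℕ} (h : CodeAt code p (incs c q p)) {i j : ℕ}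
    (hij : i + j = q) (x y : ℕ) :
    Reaches (next code) (conf c (p + i) x y) (conf c (p + q) (x + j) y) := by
  subst hij
  rw [incs, codeAt_map_range] at h
  induction j with
  | zero => exact .refl
  | succ j ih =>
    have a := next_inc (h (i + j) (by omega)) (x + j) y
    exact (ih fun k hk => h k (by omega)).trans a.to_reflTransGen

/-- Set counter `c` to zero and add `q + 1` times its value to the other counter. -/
def transfer (c : Fin 2) (q p : ℕ) : List Op :=
  [zdec c (p + q + 2) (p + 1)] ++ (incs c.rev q (p + 1) ++ [inc c.rev p])

theorem length_transfer (c : Fin 2) (q p : ℕ) : (transfer c q p).length = q + 2 := by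
  simp [transfer, incs]

theorem reaches_transfer {c : Fin 2} {q p : ℕ} (h : CodeAt code p (transfer c q p)) (x y : ℕ) :
    Reaches (next code) (conf c p x y) (conf c (p + q + 2) 0 (y + x * (q + 1))) := by
  simp only [transfer, codeAt_append, codeAt_singleton, List.length_singleton] at h
  obtain ⟨h₁, h₂, h₃⟩ := h
  induction x generalizing y with
  | zero =>
    have a : Reaches (next code) _ _ := (next_zdec_zero h₁ y).to_reflTransGen
    simpa using a
  | succ x ih =>
    have a₁ := (next_zdec_succ h₁ x y).to_reflTransGen
    have a₂ := reaches_incs h₂ (zero_add q) y x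
    rw [show (incs c.rev q (p + 1)).length = q by simp [incs]] at h₃
    have a₃ := (next_inc h₃ (y + q) x).to_reflTransGen
    rw [conf_rev, conf_rev] at a₂ a₃
    refine (a₁.trans (a₂.trans a₃)).trans ?_
    rw [show y + (x + 1) * (q + 1) = y + q + 1 + x * (q + 1) by ring]
    exact ih _

/-- Multiply counter `0` by `q + 1`, with the help of counter `1`. -/
def mul (q p : ℕ) : List Op := transfer 0 q p ++ transfer 1 0 (p + q + 2)

theorem length_mul (q p : ℕ) : (mul q p).length = q + 4 := by
  simp [mul, length_transfer]

theorem reaches_mul {q p : ℕ} (h : CodeAt code p (mul q p)) (x : ℕ) :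
    Reaches (next code) (conf 0 p x 0) (conf 0 (p + (q + 4)) (x * (q + 1)) 0) := by
  rw [mul, codeAt_append, length_transfer] at h
  have a₁ := reaches_transfer h.1 x 0
  have a₂ := reaches_transfer h.2 (x * (q + 1)) 0
  rw [show (1 : Fin 2) = Fin.rev 0 from rfl, conf_rev, conf_rev] at a₂
  rw [zero_add] at a₁
  simp only [zero_add, mul_one, add_zero] at a₂
  exact a₁.trans a₂

/-- If `q` divides counter `0`, divide by `q` and go to the end of this code, otherwise go to the
address `e` with counter `0` unchanged. The first `q` instructions form a cycle that takes `q` off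
counter `0` and adds `1` to counter `1`; the place where it is left gives the remainder. -/
def div (q p e : ℕ) : List Op :=
  (List.range q).map (fun i => zdec 0 (if i = 0 then p + 3 * q + 2 else p + 2 * q - i) (p + i + 1))
    ++ ([inc 1 p] ++ (incs 0 (q - 1) (p + q + 1) ++ (transfer 1 (q - 1) (p + 2 * q) ++
      ([zdec 1 e e] ++ transfer 1 0 (p + 3 * q + 2)))))

theorem length_div {q : ℕ} (hq : 0 < q) (p e : ℕ) : (div q p e).length = 3 * q + 4 := by
  simp [div, length_transfer, incs]
  omega

theorem codeAt_div {q p e : ℕ} (hq : 0 < q) (h : CodeAt code p (div q p e)) :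
    (∀ i < q, code (p + i) =
      zdec 0 (if i = 0 then p + 3 * q + 2 else p + 2 * q - i) (p + i + 1)) ∧
    code (p + q) = inc 1 p ∧ CodeAt code (p + q + 1) (incs 0 (q - 1) (p + q + 1)) ∧
    CodeAt code (p + 2 * q) (transfer 1 (q - 1) (p + 2 * q)) ∧
    code (p + 3 * q + 1) = zdec 1 e e ∧
    CodeAt code (p + 3 * q + 2) (transfer 1 0 (p + 3 * q + 2)) := by
  simp only [div, codeAt_append, codeAt_singleton, codeAt_map_range, List.length_singleton,
    length_transfer, List.length_map, List.length_range] at h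
  obtain ⟨h₁, h₂, h₃, h₄, h₅, h₆⟩ := h
  rw [show (incs 0 (q - 1) (p + q + 1)).length = q - 1 by simp [incs]] at h₄ h₅ h₆
  rw [show p + q + 1 + (q - 1) = p + 2 * q by omega] at h₄ h₅ h₆
  rw [show p + 2 * q + (q - 1 + 2) = p + 3 * q + 1 by omega] at h₅ h₆
  exact ⟨h₁, h₂, h₃, h₄, h₅, h₆⟩

theorem reaches_subtract {q p : ℕ} {Z : ℕ → ℕ}
    (h : ∀ i < q, code (p + i) = zdec 0 (Z i) (p + i + 1)) {j : ℕ} (hj : j ≤ q) (x y : ℕ) :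
    Reaches (next code) (conf 0 p (x + j) y) (conf 0 (p + j) x y) := by
  induction j generalizing x with
  | zero => exact .refl
  | succ j ih =>
    have a := ih (by omega) (x + 1)
    rw [add_assoc, add_comm 1 j] at a
    exact a.trans (next_zdec_succ (h j (by omega)) x y).to_reflTransGen

/-- The loop that divides counter `0` by `q` is left from its `i`-th test, where `i` is the
remainder, with the quotient added to counter `1`. -/
theorem reaches_remainder {q p : ℕ} {Z : ℕ → ℕ}
    (h : ∀ i < q, code (p + i) = zdec 0 (Z i) (p + i + 1)) (h' : code (p + q) = inc 1 p)
    {i : ℕ} (hi : i < q) (k y : ℕ) :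
    Reaches₁ (next code) (conf 0 p (k * q + i) y) (conf 0 (Z i) 0 (y + k)) := by
  induction k generalizing y with
  | zero =>
    have a := reaches_subtract h hi.le 0 y
    rw [zero_add] at a
    rw [zero_mul, zero_add, add_zero]
    exact Relation.TransGen.trans_right a (next_zdec_zero (h i hi) y)
  | succ k ih =>
    have a₁ := reaches_subtract h le_rfl (k * q + i) y
    have a₂ := (next_inc h' y (k * q + i)).to_reflTransGen
    rw [show (1 : Fin 2) = Fin.rev 0 from rfl, conf_rev, conf_rev] at a₂
    have a₃ := ih (y + 1)
    rw [show (k + 1) * q + i = k * q + i + q by ring, show y + (k + 1) = y + 1 + k by ring]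
    exact Relation.TransGen.trans_right (a₁.trans a₂) a₃

theorem reaches_div_of_not_dvd {q p e x : ℕ} (hq : 0 < q) (h : CodeAt code p (div q p e))
    (hx : ¬ q ∣ x) : Reaches (next code) (conf 0 p x 0) (conf 0 e x 0) := by
  obtain ⟨h₁, h₂, h₃, h₄, h₅, -⟩ := codeAt_div hq h
  -- The cycle is left at remainder `x % q`; jumping into the row of increments so that `x % q` of
  -- them remain, and then adding `q` times the quotient, restores `x`.
  have hmod : x % q ≠ 0 := fun h => hx (Nat.dvd_of_mod_eq_zero h)
  have hlt := Nat.mod_lt x hq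
  have a₁ := (reaches_remainder h₁ h₂ hlt (x / q) 0).to_reflTransGen
  rw [Nat.div_add_mod', if_neg hmod, zero_add] at a₁
  have a₂ := reaches_incs h₃ (i := q - 1 - x % q) (j := x % q) (by omega) 0 (x / q)
  rw [show p + q + 1 + (q - 1 - x % q) = p + 2 * q - x % q by omega,
    show p + q + 1 + (q - 1) = p + 2 * q by omega, zero_add] at a₂
  have a₃ := reaches_transfer h₄ (x / q) (x % q)
  have a₄ := (next_zdec_zero h₅ x).to_reflTransGen
  rw [show (1 : Fin 2) = Fin.rev 0 from rfl, conf_rev, conf_rev] at a₃ a₄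
  rw [show p + 2 * q + (q - 1) + 2 = p + 3 * q + 1 by omega, Nat.sub_add_cancel hq,
    Nat.mod_add_div'] at a₃
  exact a₁.trans (a₂.trans (a₃.trans a₄))

theorem reaches_div_of_dvd {q p e : ℕ} (hq : 0 < q) (h : CodeAt code p (div q p e)) (x : ℕ) :
    Reaches₁ (next code) (conf 0 p (x * q) 0) (conf 0 (p + (3 * q + 4)) x 0) := by
  obtain ⟨h₁, h₂, -, -, -, h₆⟩ := codeAt_div hq h
  have a₁ := reaches_remainder h₁ h₂ hq x 0
  have a₂ := reaches_transfer h₆ x 0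
  rw [show (1 : Fin 2) = Fin.rev 0 from rfl, conf_rev, conf_rev] at a₂
  simp only [add_zero, zero_add, if_true, mul_one] at a₁ a₂
  exact Relation.TransGen.trans_left a₁ a₂

end Op

/-! ### Register contents as a product of prime powers -/

/-- The contents of all registers as one number: the exponents of its prime factorization. -/
noncomputable def encodeRegs (s : ℕ →₀ ℕ) : ℕ := s.prod fun r n => Nat.nth Nat.Prime r ^ n

theorem encodeRegs_add (s t : ℕ →₀ ℕ) : encodeRegs (s + t) = encodeRegs s * encodeRegs t :=
  Finsupp.prod_add_index' (by simp) (by simp [pow_add])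

theorem encodeRegs_single (r n : ℕ) :
    encodeRegs (Finsupp.single r n) = Nat.nth Nat.Prime r ^ n :=
  Finsupp.prod_single_index (by simp)

theorem not_dvd_encodeRegs {r : ℕ} {s : ℕ →₀ ℕ} (h : s r = 0) :
    ¬ Nat.nth Nat.Prime r ∣ encodeRegs s := by
  have hp := (Nat.prime_nth_prime r).prime
  rw [encodeRegs, Finsupp.prod, hp.dvd_finsetProd_iff]
  rintro ⟨i, hi, hd⟩
  have := (Nat.prime_dvd_prime_iff_eq hp.nat_prime (Nat.prime_nth_prime i)).1 (hp.dvd_of_dvd_pow hd)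
  rw [Nat.nth_injective Nat.infinite_setOfPred_prime this] at h
  exact Finsupp.mem_support_iff.1 hi h

/-! ### Compilation of loop programs -/

namespace Prog

open Op StateTransition Finsupp

/-- Code for the program from address `p` on, acting on `encodeRegs` of the registers in
counter `0`. Counter `1` is zero before and after. -/
noncomputable def compile : Prog → ℕ → List Op
  | skip, _ => []
  | inc r, p => mul (Nat.nth Nat.Prime r - 1) p
  | seq a b, p => a.compile p ++ b.compile (p + (a.compile p).length)
  | loop r a, p =>
      let b := a.compile (p + (3 * Nat.nth Nat.Prime r + 4))
      div (Nat.nth Nat.Prime r) p (p + (3 * Nat.nth Nat.Prime r + 4 + (b.length + 1))) ++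
        (b ++ [zdec 1 p p])

variable {code : ℕ → Op}

theorem reaches_loop_zero {r p : ℕ} {a : Prog} {s : ℕ →₀ ℕ}
    (h : CodeAt code p (compile (loop r a) p)) (hs : s r = 0) :
    Reaches (next code) (conf 0 p (encodeRegs s) 0)
      (conf 0 (p + (compile (loop r a) p).length) (encodeRegs s) 0) := by
  have hq := (Nat.prime_nth_prime r).pos
  rw [compile, codeAt_append] at h
  have := reaches_div_of_not_dvd hq h.1 (not_dvd_encodeRegs hs)
  simpa [compile, length_div hq] using this

/-- One round of a loop with a terminating body; at least one step is taken. -/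
theorem reaches_loop_succ {r p : ℕ} {a : Prog} {s t : ℕ →₀ ℕ}
    (h : CodeAt code p (compile (loop r a) p))
    (ha : ∀ p', CodeAt code p' (compile a p') → Reaches (next code) (conf 0 p' (encodeRegs s) 0)
      (conf 0 (p' + (compile a p').length) (encodeRegs t) 0)) :
    Reaches₁ (next code) (conf 0 p (encodeRegs (s + single r 1)) 0)
      (conf 0 p (encodeRegs t) 0) := by
  have hq := (Nat.prime_nth_prime r).pos
  rw [compile, codeAt_append, codeAt_append, codeAt_singleton, length_div hq] at h
  obtain ⟨h₁, h₂, h₃⟩ := h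
  have a₁ := reaches_div_of_dvd hq h₁ (encodeRegs s)
  have a₃ := (next_zdec_zero h₃ (encodeRegs t)).to_reflTransGen
  rw [show (1 : Fin 2) = Fin.rev 0 from rfl, conf_rev, conf_rev] at a₃
  rw [encodeRegs_add, encodeRegs_single, pow_one]
  exact a₁.trans_left ((ha _ h₂).trans a₃)

/-- Compiled programs simulate their source. The converse, that the code terminates only if the
program does, is not needed, since primitive recursive functions are total. -/
theorem Exec.reaches {a : Prog} {s t : ℕ →₀ ℕ} (h : Exec a s t) {p : ℕ}
    (hp : CodeAt code p (compile a p)) :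
    Reaches (next code) (conf 0 p (encodeRegs s) 0)
      (conf 0 (p + (compile a p).length) (encodeRegs t) 0) := by
  induction h generalizing p with
  | skip s => exact .refl
  | inc r s =>
    have := reaches_mul hp (encodeRegs s)
    rw [Nat.sub_add_cancel (Nat.prime_nth_prime r).pos] at this
    rwa [compile, length_mul, encodeRegs_add, encodeRegs_single, pow_one]
  | seq _ _ ih₁ ih₂ =>
    rw [compile, codeAt_append] at hp
    rw [compile, List.length_append, ← add_assoc]
    exact (ih₁ hp.1).trans (ih₂ hp.2)
  | loop_zero hs => exact reaches_loop_zero hp hs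
  | loop_succ _ _ ih₁ ih₂ =>
    exact (reaches_loop_succ hp fun _ => ih₁).to_reflTransGen.trans (ih₂ hp)

end Prog

/-! ### Unbounded search -/

namespace Op

open StateTransition Finsupp

theorem _root_.StateTransition.not_dom_of_reaches₁ {σ : Type*} {f : σ → Option σ} {c : ℕ → σ}
    (h : ∀ k, Reaches₁ f (c k) (c (k + 1))) : ¬ (eval f (c 0)).Dom := by
  have H : Respects (fun k : ℕ => some (k + 1)) f fun k a => a = c k := by
    rintro k _ rfl
    exact ⟨_, rfl, h k⟩
  rw [tr_eval_dom H rfl, Part.dom_iff_mem]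
  rintro ⟨b, hb⟩
  simpa using (mem_eval.1 hb).2

/-- A two-counter code can search for a zero of a primitive recursive function. -/
theorem exists_search {t : List.Vector ℕ 2 → ℕ} (ht : Nat.Primrec' t) :
    ∃ l : List Op, ∀ x, (eval (next fun i => l.getD i halt) (conf 0 0 (2 ^ x) 0)).Dom ↔
      ∃ k, t (x ::ᵥ k ::ᵥ .nil) = 0 := by
  -- Registers `0`, `1` and `2` hold `x`, `k` and the value of `t`.
  obtain ⟨a, ha⟩ := ht.computes ![0, 1] 2 (by simp [Fin.forall_fin_two])
  let body : Prog := .seq (.clear 2) (.seq (.inc 1) a)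
  let h := (a.compile 0).length
  let l := a.compile 0 ++ (Prog.loop 2 body).compile h
  refine ⟨l, fun x => ?_⟩
  set code : ℕ → Op := fun i => l.getD i halt with hcode
  have hl : CodeAt code 0 l := fun i hi => by simp [hcode, hi]
  obtain ⟨hl₁, hl₂⟩ := codeAt_append.1 hl
  rw [zero_add] at hl₂
  let T (k : ℕ) : ℕ := t (x ::ᵥ k ::ᵥ .nil)
  let S (k : ℕ) : ℕ →₀ ℕ := single 0 x + single 1 k
  have hexec (k : ℕ) : Prog.Exec a (S k) (S k + single 2 (T k)) := by
    refine ha _ _ (fun r hr => ?_) ?_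
    · simp only [S, Finsupp.add_apply]
      rw [single_eq_of_ne (by omega), single_eq_of_ne (by omega), add_zero]
    · simpa [S, Fin.forall_fin_two] using (List.Vector.get_cons_succ x (k ::ᵥ .nil) 0).symm
  have hstart : Reaches (next code) (conf 0 0 (2 ^ x) 0)
      (conf 0 h (encodeRegs (S 0 + single 2 (T 0))) 0) := by
    have := (hexec 0).reaches hl₁
    rwa [zero_add, show encodeRegs (S 0) = 2 ^ x by
      simp [S, encodeRegs_single, Nat.nth_prime_zero_eq_two]] at this
  have hround (k : ℕ) (hk : T k ≠ 0) :
      Reaches₁ (next code) (conf 0 h (encodeRegs (S k + single 2 (T k))) 0)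
        (conf 0 h (encodeRegs (S (k + 1) + single 2 (T (k + 1)))) 0) := by
    obtain ⟨m, hm⟩ := Nat.exists_eq_succ_of_ne_zero hk
    have hb : Prog.Exec body (S k + single 2 m) (S (k + 1) + single 2 (T (k + 1))) :=
      (Prog.exec_clear (by simp [S]) m).seq
        (.seq ((Prog.Exec.inc 1 (S k)).congr rfl (by simp [S, add_assoc])) (hexec (k + 1)))
    have := Prog.reaches_loop_succ hl₂ fun _ => hb.reaches
    rwa [add_assoc, ← single_add, ← Nat.succ_eq_add_one, ← hm] at this
  rw [reaches_eval hstart]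
  constructor
  · intro hdom
    by_contra! hT
    exact not_dom_of_reaches₁ (c := fun k => conf 0 h (encodeRegs (S k + single 2 (T k))) 0)
      (fun k => hround k (hT k)) hdom
  · intro hT
    classical
    have hreach (k : ℕ) (hk : ∀ i < k, T i ≠ 0) :
        Reaches (next code) (conf 0 h (encodeRegs (S 0 + single 2 (T 0))) 0)
          (conf 0 h (encodeRegs (S k + single 2 (T k))) 0) := by
      induction k with
      | zero => exact .refl
      | succ k ih =>
        exact (ih fun i hi => hk i (by omega)).trans (hround k (hk k (by omega))).to_reflTransGen
    have a₁ := hreach (Nat.find hT) fun i hi => Nat.find_min hT hi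
    have hzero : T (Nat.find hT) = 0 := Nat.find_spec hT
    have a₂ := Prog.reaches_loop_zero hl₂ (s := S (Nat.find hT) + single 2 (T (Nat.find hT)))
      (by simp [S, hzero])
    refine Part.dom_iff_mem.2 ⟨_, mem_eval.2 ⟨a₁.trans a₂, ?_⟩⟩
    simp [next, conf, hcode, l, h]

end Op

namespace CounterMachine

open StateTransition Op

/-- The counter machine with the instructions `l`, and a final `halt` to which all addresses
beyond `l` are redirected. -/
def ofOps (l : List Op) : CounterMachine where
  m := l.length
  code i := match l.getD i .halt with
    | .inc c k => .inc c ⟨min k l.length, by omega⟩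
    | .zdec c k k' => .zdec c ⟨min k l.length, by omega⟩ ⟨min k' l.length, by omega⟩
    | .halt => .halt

theorem ofOps_halts_iff (l : List Op) (i j : ℕ) :
    (ofOps l).Halts i j ↔ (eval (next fun i => l.getD i halt) (conf 0 0 i j)).Dom := by
  let tr (C : ℕ × (Fin 2 → ℕ)) : (ofOps l).Config :=
    (⟨min C.1 l.length, by simp [ofOps]⟩, C.2)
  have H : Respects (next fun i => l.getD i halt) (ofOps l).step fun a b => tr a = b := by
    rw [fun_respects]
    rintro ⟨p, v⟩
    -- Beyond the end of `l`, `getD` yields `halt`, so redirecting addresses changes nothing.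
    have hp : l.getD (min p l.length) halt = l.getD p halt := by
      rcases le_total p l.length with h | h <;> simp [h]
    have hstep : (ofOps l).step (tr (p, v)) =
        (next (fun i => l.getD i halt) (p, v)).map tr := by
      simp only [step, next, ofOps, tr, hp]
      cases l.getD p halt with
      | inc c k => rfl
      | zdec c k k' =>
        dsimp only
        split <;> rfl
      | halt => rfl
    unfold FRespects
    cases hn : next (fun i => l.getD i halt) (p, v) with
    | none =>
      rw [hn] at hstep
      exact hstep
    | some b =>
      rw [hn] at hstep
      exact .single hstep
  rw [← tr_eval_dom H rfl, Part.dom_iff_mem]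
  have h0 : tr (conf 0 0 i j) = (0, ![i, j]) := by
    refine Prod.ext (Fin.ext (by simp [tr, conf])) ?_
    funext d
    fin_cases d <;> rfl
  simp only [mem_eval, h0]
  rfl

open Nat.Partrec in
/-- Some counter machine halts, when started with `2 ^ x` and `0`, exactly if the partial recursive
function with code `x` is defined at `0`. -/
theorem exists_universal : ∃ M : CounterMachine, ∀ c : Code,
    M.Halts (2 ^ Encodable.encode c) 0 ↔ (Code.eval c 0).Dom := by
  -- `t` is zero if the evaluation with step bound `v.get 1` succeeds.
  let t (v : List.Vector ℕ 2) : ℕ :=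
    Option.casesOn (motive := fun _ => ℕ)
      (Code.evaln (v.get 1) (Denumerable.ofNat Code (v.get 0)) 0) 1 fun _ => 0
  have ht : Primrec t := by
    have h (i : Fin 2) : Primrec fun v : List.Vector ℕ 2 => v.get i :=
      Primrec.vector_get.comp .id (.const i)
    exact Primrec.option_casesOn
      (Code.primrec_evaln.comp (((h 1).pair ((Primrec.ofNat Code).comp (h 0))).pair (.const 0)))
      (.const 1) (Primrec.const 0).to₂
  obtain ⟨l, hl⟩ := exists_search (Nat.Primrec'.of_prim ht)
  refine ⟨ofOps l, fun c => ?_⟩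
  rw [ofOps_halts_iff, hl, Part.dom_iff_mem]
  simp only [Code.evaln_complete]
  rw [exists_comm]
  refine exists_congr fun k => ?_
  have : t (Encodable.encode c ::ᵥ k ::ᵥ .nil) =
      Option.casesOn (motive := fun _ => ℕ) (Code.evaln k c 0) 1 fun _ => 0 := by
    change Option.casesOn (motive := fun _ => ℕ)
      (Code.evaln k (Denumerable.ofNat Code (Encodable.encode c)) 0) 1 _ = _
    rw [Denumerable.ofNat_encode]
  rw [this]
  cases Code.evaln k c 0 <;> simp

theorem exists_not_computablePred :
    ∃ M : CounterMachine, ¬ ComputablePred fun p : ℕ × ℕ => ¬ M.Halts p.1 p.2 := by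
  obtain ⟨M, hM⟩ := exists_universal
  refine ⟨M, fun h => ComputablePred.halting_problem 0 ?_⟩
  have hpow : Computable fun c : Nat.Partrec.Code => ((2 ^ Encodable.encode c, 0) : ℕ × ℕ) := by
    refine Primrec.to_comp (Primrec.pair ?_ (.const 0))
    have : Primrec fun n : ℕ => 2 ^ n :=
      (Primrec.nat_rec₁ 1 (Primrec.nat_mul.comp .snd (.const 2)).to₂).of_eq fun n => by
        induction n with
        | zero => rfl
        | succ n ih => simp [ih, pow_succ]
    exact this.comp .encode
  obtain ⟨f, hf, hp⟩ := ComputablePred.computable_iff.1 h.not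
  refine ComputablePred.computable_iff.2 ⟨_, hf.comp hpow, ?_⟩
  funext c
  rw [← hM]
  simpa using congrFun hp (2 ^ Encodable.encode c, 0)

end CounterMachine

end RefinedSession
open RefinedSession
theorem theorem1 :
    -- non-halting of every two-counter machine is expressed by type equality in the fragment
    (∀ M : CounterMachine, ∃ P : TypePair, P.Valid ∧ P.InFragment ∧
      ∀ i j : ℕ, (P.EqualAt i j ↔ ¬ M.Halts i j) ∧ (P.IsoEqualAt i j ↔ ¬ M.Halts i j)) ∧
    -- undecidability in `i`, `j`, already for one fixed signature and one fixed pair of types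
    (∃ P : TypePair, P.Valid ∧ P.InFragment ∧
      ¬ ComputablePred (fun p : ℕ × ℕ => P.EqualAt p.1 p.2) ∧
      ¬ ComputablePred (fun p : ℕ × ℕ => P.IsoEqualAt p.1 p.2)) ∧
    -- undecidability with the signature and the types as input, under any numbering of these:
    -- no algorithm is correct on all valid inputs of the fragment
    (∀ num : TypePair → ℕ,
      (¬ ∃ f : ℕ × ℕ × ℕ →. Bool, Partrec f ∧
        ∀ P : TypePair, P.Valid → P.InFragment → ∀ i j : ℕ,
          ∃ b : Bool, b ∈ f (num P, i, j) ∧ (b = true ↔ P.EqualAt i j)) ∧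
      (¬ ∃ f : ℕ × ℕ × ℕ →. Bool, Partrec f ∧
        ∀ P : TypePair, P.Valid → P.InFragment → ∀ i j : ℕ,
          ∃ b : Bool, b ∈ f (num P, i, j) ∧ (b = true ↔ P.IsoEqualAt i j))) := by
  obtain ⟨M, hM⟩ := CounterMachine.exists_not_computablePred
  have hEq : ¬ ComputablePred fun p : ℕ × ℕ => M.typePair.EqualAt p.1 p.2 := by
    simpa only [M.typePair_equalAt_iff] using hM
  have hIso : ¬ ComputablePred fun p : ℕ × ℕ => M.typePair.IsoEqualAt p.1 p.2 := by
    simpa only [M.typePair_isoEqualAt_iff] using hM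
  have hdec {a : ℕ} {f : ℕ × ℕ × ℕ →. Bool} (hf : Partrec f) {E : ℕ → ℕ → Prop}
      (h : ∀ i j, ∃ b : Bool, b ∈ f (a, i, j) ∧ (b = true ↔ E i j)) :
      ComputablePred fun p : ℕ × ℕ => E p.1 p.2 := by
    choose g hg hgE using h
    refine ComputablePred.computable_iff.2 ⟨fun p => g p.1 p.2, ?_, ?_⟩
    · exact (hf.comp ((Computable.const a).pair .id)).of_eq fun p => Part.eq_some_iff.2 (hg _ _)
    · funext p
      exact propext (hgE _ _).symm
  refine ⟨fun M => ⟨M.typePair, M.typePair_valid, M.typePair_inFragment, fun i j =>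
    ⟨M.typePair_equalAt_iff i j, M.typePair_isoEqualAt_iff i j⟩⟩,
    ⟨M.typePair, M.typePair_valid, M.typePair_inFragment, hEq, hIso⟩, fun num => ⟨?_, ?_⟩⟩
  · rintro ⟨f, hf, h⟩
    exact hEq (hdec hf (h _ M.typePair_valid M.typePair_inFragment))
  · rintro ⟨f, hf, h⟩
    exact hIso (hdec hf (h _ M.typePair_valid M.typePair_inFragment))
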